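/- Let $D\subset\mathbb C^n$ be a bounded B-regular domain (every continuous real function on $\partial D$ is the boundary value of a function in $\operatorname{PSH}(D)\cap C(\overline D)$), and let $V\subset\partial D$ be non-empty and relatively open in $\partial D$. Let $\operatorname{PSH}(D)^-$ be the set of non-positive plurisubharmonic functions on $D$ and, for $\zeta\in\overline D$, $u^*(\zeta)=\limsup_{D\ni w\to \zeta}u(w)$. Put $$\omega(z,V,D)=\sup\{u(z):u\in \operatorname{PSH}(D)^-,\ u^*\le -1\text{ on }V\}\qquad(z\in D).$$ A set $A\subset\partial D$ is called b-pluripolar if there is $u\in\operatorname{PSH}(D)^-$, $u\not\equiv-\infty$, with $u^*=-\infty$ on $A$. For a topological space $X$, a convex cone $F\subset C(X)$ containing the constants, $g:X\to\mathbb R$ and $z\in X$, let $J^F_z(X)$ be the set of Borel probability measures $\mu$ with compact support in $X$ such that $u(z)\le\int u\,d\mu$ for all $u\in F$, and put $$Sg(z)=\sup\{u(z):u\in F,\ u\le g\},\qquad Ig(z)=\inf\Big\{\int_X g\,d\mu:\mu\in J^F_z(X)\Big\}.$$ We say that Edwards' theorem holds on $X$ if for all such $F$ and every bounded Borel function $g$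 on $X$ one has $Sg\le Ig$ on $X$, with $Sg=Ig$ on $X$ whenever $g$ is lower semicontinuous. Then Edwards' theorem does not hold on $D$. More precisely: 1. Neither $V$ nor $\overline V$ is b-pluripolar, and $\omega(z,V,D)<0$ for all $z\in D$. 2. There is a non-empty countable set $L\subset D$ without accumulation points in $D$ such that $\overline L=L\cup\overline V$ is compact. 3. $F=\operatorname{PSH}(D)\cap C(\overline D)$, viewed (by restriction) as a subset of $C(D)$, is a convex cone containing the constants. For every $L$ as in 2, the function $g=-\chi_L$ on $D$ is bounded, Borel and lower semicontinuous, $Sg\le\omega(\cdot,V,D)$ on $D$, and $Ig=0$ on $D\setminus L\neq\emptyset$. Hence $Sg=Ig$ on $D$ would force $0\le\omega(\cdot,V,D)$ on $D\setminus L$, contradicting 1; in fact $Sg(z)<Ig(z)$ for all $z\in D\setminus L$. -/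

import Mathlib

open Set Filter Topology MeasureTheory

noncomputable section

/-- The integral of a quasi-integrable function with values in `[-∞, ∞]`:
the integral of the positive part minus the integral of the negative part. -/
def extIntegral {α : Type*} [MeasurableSpace α] (μ : Measure α) (f : α → EReal) : EReal :=
  ((∫⁻ x, (f x).toENNReal ∂μ : ENNReal) : EReal) - ((∫⁻ x, (-f x).toENNReal ∂μ : ENNReal) : EReal)

/-- The mean `(1 / 2π) ∫₀^{2π} f(θ) dθ` of an extended real valued function. -/
def angularMean (f : ℝ → EReal) : EReal :=
  extIntegral (ENNReal.ofReal (2 * Real.pi)⁻¹ • volume.restrict (Ioc 0 (2 * Real.pi))) f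

/-- `u ∈ PSH(D)`: `u : D → [-∞, ∞)` is upper semicontinuous and satisfies the sub-mean value
inequality on every closed complex disc `{a + ζ b : |ζ| ≤ 1}` contained in `D`.
The function that is identically `-∞` is allowed; values of `u` outside `D` play no role. -/
structure IsPSH {n : ℕ} (D : Set (EuclideanSpace ℂ (Fin n)))
    (u : EuclideanSpace ℂ (Fin n) → EReal) : Prop where
  lt_top : ∀ z ∈ D, u z < ⊤
  usc : UpperSemicontinuousOn u D
  le_mean : ∀ a ∈ D, ∀ b : EuclideanSpace ℂ (Fin n),
    (∀ ζ : ℂ, ‖ζ‖ ≤ 1 → a + ζ • b ∈ D) →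
      u a ≤ angularMean (fun θ => u (a + Complex.exp (θ * Complex.I) • b))

/-- `h ∈ PSH(D) ∩ C(closure D)`, for a real valued `h`. -/
def IsContPSH {n : ℕ} (D : Set (EuclideanSpace ℂ (Fin n)))
    (h : EuclideanSpace ℂ (Fin n) → ℝ) : Prop :=
  ContinuousOn h (closure D) ∧ IsPSH D (fun z => (h z : EReal))

/-- Every continuous real function on `∂D` is the boundary value of a function in
`PSH(D) ∩ C(closure D)`. -/
def IsBRegular {n : ℕ} (D : Set (EuclideanSpace ℂ (Fin n))) : Prop :=
  ∀ φ : EuclideanSpace ℂ (Fin n) → ℝ, ContinuousOn φ (frontier D) →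
    ∃ h, IsContPSH D h ∧ EqOn h φ (frontier D)

/-- `u^*(z) = limsup_{ζ → z, ζ ∈ D} u(ζ)` for `z ∈ closure D`. -/
def upperReg {n : ℕ} (D : Set (EuclideanSpace ℂ (Fin n)))
    (u : EuclideanSpace ℂ (Fin n) → EReal) (z : EuclideanSpace ℂ (Fin n)) : EReal :=
  limsup u (𝓝[D] z)

/-- `u ∈ PSH(D)^-`, the non-positive plurisubharmonic functions. -/
def IsNonposPSH {n : ℕ} (D : Set (EuclideanSpace ℂ (Fin n)))
    (u : EuclideanSpace ℂ (Fin n) → EReal) : Prop :=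
  IsPSH D u ∧ ∀ z ∈ D, u z ≤ 0

/-- The boundary relative extremal function
`ω(z, A, D) = sup {u(z) : u ∈ PSH(D)^-, u^* ≤ -1 on A}` of `A ⊆ ∂D`. -/
def boundaryExtremal {n : ℕ} (A D : Set (EuclideanSpace ℂ (Fin n)))
    (z : EuclideanSpace ℂ (Fin n)) : EReal :=
  sSup {t : EReal | ∃ u, IsNonposPSH D u ∧ (∀ ζ ∈ A, upperReg D u ζ ≤ -1) ∧ t = u z}

/-- `A ⊆ ∂D` is b-pluripolar: some `u ∈ PSH(D)^-`, `u ≢ -∞`, has `u^* = -∞` on `A`. -/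
def IsBPluripolar {n : ℕ} (D A : Set (EuclideanSpace ℂ (Fin n))) : Prop :=
  ∃ u, IsNonposPSH D u ∧ (∃ z ∈ D, u z ≠ ⊥) ∧ ∀ ζ ∈ A, upperReg D u ζ = ⊥

/-- The Borel probability measures `μ` with compact support in `X` such that
`u(z) ≤ ∫ u dμ` for all `u ∈ F`. -/
def jensenMeasures {X : Type*} [TopologicalSpace X] [MeasurableSpace X]
    (F : ConvexCone ℝ C(X, ℝ)) (z : X) : Set (Measure X) :=
  {μ | IsProbabilityMeasure μ ∧ (∃ K : Set X, IsCompact K ∧ μ Kᶜ = 0) ∧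
    ∀ u ∈ F, u z ≤ ∫ x, u x ∂μ}

/-- `Sg(z) = sup {u(z) : u ∈ F, u ≤ g}`. -/
def edwardsS {X : Type*} [TopologicalSpace X]
    (F : ConvexCone ℝ C(X, ℝ)) (g : X → ℝ) (z : X) : EReal :=
  sSup {t : EReal | ∃ u ∈ F, (∀ x, u x ≤ g x) ∧ t = (u z : EReal)}

/-- `Ig(z) = inf {∫ g dμ : μ ∈ J_z^F}`. -/
def edwardsI {X : Type*} [TopologicalSpace X] [MeasurableSpace X]
    (F : ConvexCone ℝ C(X, ℝ)) (g : X → ℝ) (z : X) : EReal :=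
  sInf {t : EReal | ∃ μ ∈ jensenMeasures F z, t = ((∫ x, g x ∂μ : ℝ) : EReal)}

/-- The assertion of Edwards' theorem on the space `X`: for every convex cone `F ⊆ C(X)`
containing the constants and every bounded Borel function `g` on `X` one has `Sg ≤ Ig`,
with equality if `g` is lower semicontinuous. -/
def EdwardsHolds (X : Type*) [TopologicalSpace X] [MeasurableSpace X] : Prop :=
  ∀ F : ConvexCone ℝ C(X, ℝ), (∀ c : ℝ, ContinuousMap.const X c ∈ F) →
    ∀ g : X → ℝ, Measurable g → (∃ M : ℝ, ∀ x, |g x| ≤ M) →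
      (∀ z, edwardsS F g z ≤ edwardsI F g z) ∧
      (LowerSemicontinuous g → ∀ z, edwardsS F g z = edwardsI F g z)

/-- `L` is a countable subset of `D` without accumulation points in `D` and
`closure L = L ∪ closure V` is compact. -/
structure IsDiscreteApprox {n : ℕ} (D V L : Set (EuclideanSpace ℂ (Fin n))) : Prop where
  subset : L ⊆ D
  nonempty : L.Nonempty
  countable : L.Countable
  closure_eq : closure L = L ∪ closure V
  isCompact : IsCompact (closure L)
  no_acc : ∀ z ∈ D, ¬ AccPt z (𝓟 L)

/-- The function `-χ_L` on `D`. -/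
def negChar {n : ℕ} (D L : Set (EuclideanSpace ℂ (Fin n))) : D → ℝ :=
  fun x => -(L.indicator (fun _ => (1 : ℝ)) (x : EuclideanSpace ℂ (Fin n)))

end

/-! Jensen measures see only the interior of `D`, while the functions of `F` feel boundary values
through continuity up to the boundary; `-χ_L` exploits this gap.

On the measure side, the maps `w ↦ log⁺ (c |⟨e, w - p⟩|)` vanish at `p` but grow like `log c` at
`z`. Letting `c → ∞` shows that a Jensen measure at `z` has no mass at `p ≠ z`
(`jensenMeasures_singleton_eq_zero`). So it does not charge a countable `L` avoiding `z`, and `Ig z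
= 0`.

On the function side, `u ≤ -1` on `L` forces `u ≤ -1` on `V ⊆ closure L`, so `u` competes in `ω(·,
V, D)` (`edwardsS_negChar_le`). That `ω < 0` comes from B-regularity: a boundary bump `h` supported
in `V` gives `u ≤ -c h` by the maximum principle, hence a negative bound near a point of `V`, which
chains of discs spread over the connected `D` (`IsBRegular.exists_pos_forall_le`). Linearity of this
estimate in `c` also excludes b-pluripolarity. -/

/-! ### Means over circles. -/

/-- The normalized measure `dθ / 2π` on `(0, 2π]`. -/
noncomputable def angularMeasure : Measure ℝ :=
  ENNReal.ofReal (2 * Real.pi)⁻¹ • volume.restrict (Ioc 0 (2 * Real.pi))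

instance : IsProbabilityMeasure angularMeasure := by
  constructor
  have : (0 : ℝ) < 2 * Real.pi := by positivity
  rw [angularMeasure, Measure.smul_apply, Measure.restrict_apply_univ, Real.volume_Ioc, smul_eq_mul,
    sub_zero, ← ENNReal.ofReal_mul (by positivity), inv_mul_cancel₀ this.ne', ENNReal.ofReal_one]

lemma integral_angularMeasure (f : ℝ → ℝ) :
    ∫ θ, f θ ∂angularMeasure = (2 * Real.pi)⁻¹ * ∫ θ in (0)..(2 * Real.pi), f θ := by
  rw [angularMeasure, integral_smul_measure, ENNReal.toReal_ofReal (by positivity), smul_eq_mul,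
    intervalIntegral.integral_of_le (by positivity)]

lemma IntervalIntegrable.integrable_angularMeasure {f : ℝ → ℝ}
    (hf : IntervalIntegrable f volume 0 (2 * Real.pi)) : Integrable f angularMeasure := by
  refine Integrable.smul_measure ?_ ENNReal.ofReal_ne_top
  exact (intervalIntegrable_iff_integrableOn_Ioc_of_le (by positivity)).1 hf

lemma Continuous.integrable_angularMeasure {f : ℝ → ℝ} (hf : Continuous f) :
    Integrable f angularMeasure :=
  (hf.intervalIntegrable _ _).integrable_angularMeasure

lemma integral_angularMeasure_circleMap (f : ℂ → ℝ) :
    ∫ θ : ℝ, f (Complex.exp (θ * Complex.I)) ∂angularMeasure = Real.circleAverage f 0 1 := by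
  rw [integral_angularMeasure, Real.circleAverage_def]
  simp [circleMap]

lemma extIntegral_mono {α : Type*} [MeasurableSpace α] {μ : Measure α} {f g : α → EReal}
    (h : ∀ x, f x ≤ g x) : extIntegral μ f ≤ extIntegral μ g := by
  refine EReal.sub_le_sub ?_ ?_
  · exact EReal.coe_ennreal_le_coe_ennreal_iff.2
      (lintegral_mono fun x => EReal.toENNReal_le_toENNReal (h x))
  · exact EReal.coe_ennreal_le_coe_ennreal_iff.2
      (lintegral_mono fun x => EReal.toENNReal_le_toENNReal (EReal.neg_le_neg_iff.2 (h x)))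

lemma extIntegral_coe {α : Type*} [MeasurableSpace α] {μ : Measure α} {f : α → ℝ}
    (hf : Integrable f μ) : extIntegral μ (fun x => (f x : EReal)) = ((∫ x, f x ∂μ : ℝ) : EReal) := by
  have h1 : ∫⁻ x, ENNReal.ofReal (f x) ∂μ ≠ ⊤ := hf.lintegral_lt_top.ne
  have h2 : ∫⁻ x, ENNReal.ofReal (-f x) ∂μ ≠ ⊤ := hf.neg.lintegral_lt_top.ne
  rw [integral_eq_lintegral_pos_part_sub_lintegral_neg_part hf, EReal.coe_sub,
    EReal.coe_ennreal_toReal h1, EReal.coe_ennreal_toReal h2]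
  rfl

lemma angularMean_coe {f : ℝ → ℝ} (hf : Integrable f angularMeasure) :
    angularMean (fun θ => (f θ : EReal)) = ((∫ θ, f θ ∂angularMeasure : ℝ) : EReal) :=
  extIntegral_coe hf

lemma angularMean_le_integral {u : ℝ → EReal} {q : ℝ → ℝ} (hq : Integrable q angularMeasure)
    (h : ∀ θ, u θ ≤ q θ) : angularMean u ≤ ((∫ θ, q θ ∂angularMeasure : ℝ) : EReal) :=
  (extIntegral_mono h).trans_eq (extIntegral_coe hq)

lemma integral_norm_add_circle_sq {E : Type*} [NormedAddCommGroup E] [InnerProductSpace ℂ E]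
    (a b : E) : ∫ θ : ℝ, ‖a + Complex.exp (θ * Complex.I) • b‖ ^ 2 ∂angularMeasure
      = ‖a‖ ^ 2 + ‖b‖ ^ 2 := by
  have key : ∀ θ : ℝ, ‖a + Complex.exp (θ * Complex.I) • b‖ ^ 2
      = (‖a‖ ^ 2 + ‖b‖ ^ 2)
        + 2 * (Complex.exp (θ * Complex.I) * inner ℂ a b).re := by
    intro θ
    rw [norm_add_sq (𝕜 := ℂ), inner_smul_right, norm_smul, Complex.norm_exp_ofReal_mul_I, one_mul]
    simp only [RCLike.re_eq_complex_re]
    ring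
  have hc : Continuous fun θ : ℝ => Complex.exp (θ * Complex.I) * inner ℂ a b := by fun_prop
  have h0 : ∫ θ : ℝ in (0)..(2 * Real.pi), Complex.exp (θ * Complex.I) * inner ℂ a b = 0 := by
    rw [intervalIntegral.integral_mul_const]
    have := integral_exp_mul_complex (a := 0) (b := 2 * Real.pi) Complex.I_ne_zero
    simp_rw [mul_comm Complex.I] at this
    rw [this]
    simp [Complex.exp_two_pi_mul_I]
  have h1 : ∫ θ : ℝ in (0)..(2 * Real.pi), (Complex.exp (θ * Complex.I) * inner ℂ a b).re = 0 := by
    have := intervalIntegral.intervalIntegral_re (𝕜 := ℂ) (hc.intervalIntegrable (μ := volume) 0 (2 * Real.pi))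
    simp only [RCLike.re_eq_complex_re] at this
    rw [this, h0, Complex.zero_re]
  simp_rw [key]
  rw [integral_add (integrable_const _)
    (Continuous.integrable_angularMeasure (by fun_prop)), integral_const_mul,
    integral_angularMeasure fun θ : ℝ => (Complex.exp (θ * Complex.I) * inner ℂ a b).re, h1]
  simp

/-- Factoring out `β` leaves the mean of `log |w + α/β|` over the unit circle, which is `log⁺ |α/β|
≥ log |α/β|`. The factorization can fail only at the zero `w = -α/β`, hence the codiscrete
congruence. -/
lemma log_norm_le_circleAverage (α β : ℂ) (hα : α ≠ 0) (hβ : β ≠ 0) :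
    Real.log ‖α‖ ≤ Real.circleAverage (fun w => Real.log ‖α + w * β‖) 0 1 := by
  have hcongr : (fun w => Real.log ‖α + w * β‖)
      =ᶠ[codiscreteWithin (Metric.sphere (0 : ℂ) |1|)]
      fun w => Real.log ‖β‖ + Real.log ‖w + α / β‖ := by
    have hmem : {w : ℂ | w + α / β ≠ 0} ∈ codiscreteWithin (Metric.sphere (0 : ℂ) |1|) := by
      refine codiscreteWithin_iff_locallyFiniteComplementWithin.2 fun z _ => ⟨Set.univ, univ_mem, ?_⟩
      refine Set.Finite.subset (Set.finite_singleton (-(α / β))) ?_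
      rintro w ⟨-, -, hw⟩
      simpa [add_eq_zero_iff_eq_neg] using hw
    filter_upwards [hmem] with w hw
    rw [← Real.log_mul (norm_ne_zero_iff.2 hβ) (norm_ne_zero_iff.2 hw), ← norm_mul]
    congr 2
    field_simp
    ring
  rw [Real.circleAverage_congr_codiscreteWithin hcongr one_ne_zero]
  have hadd := Real.circleAverage_add (circleIntegrable_const (Real.log ‖β‖) (0 : ℂ) 1)
    (MeromorphicOn.circleIntegrable_log_norm (f := fun w : ℂ => w + α / β) (c := 0) (R := 1)
      (fun _ _ => by fun_prop))
  rw [Real.circleAverage_const, circleAverage_log_norm_add_const_eq_posLog] at hadd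
  refine le_trans ?_ hadd.ge
  calc Real.log ‖α‖ = Real.log ‖β‖ + Real.log ‖α / β‖ := by
        rw [norm_div, Real.log_div (norm_ne_zero_iff.2 hα) (norm_ne_zero_iff.2 hβ)]
        ring
    _ ≤ _ := by
        rw [Real.posLog_apply]
        gcongr
        exact le_max_right _ _

lemma posLog_norm_le_integral (α β : ℂ) :
    Real.posLog ‖α‖ ≤
      ∫ θ : ℝ, Real.posLog ‖α + Complex.exp (θ * Complex.I) * β‖ ∂angularMeasure := by
  rcases le_or_gt ‖α‖ 1 with h | h
  · rw [(Real.posLog_eq_zero_iff _).2 (by simpa using h)]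
    exact integral_nonneg fun _ => Real.posLog_nonneg
  rcases eq_or_ne β 0 with rfl | hβ
  · simp
  have hα : α ≠ 0 := by
    rintro rfl
    norm_num at h
  rw [Real.posLog_eq_log (by simpa using h.le),
    integral_angularMeasure_circleMap fun w => Real.posLog ‖α + w * β‖]
  refine (log_norm_le_circleAverage α β hα hβ).trans (Real.circleAverage_mono ?_ ?_ ?_)
  · exact MeromorphicOn.circleIntegrable_log_norm (f := fun w : ℂ => α + w * β)
      (fun _ _ => by fun_prop)
  · refine Continuous.intervalIntegrable ?_ _ _
    exact Real.continuous_posLog.comp (by fun_prop)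
  · intro w _
    rw [Real.posLog_apply]
    exact le_max_right _ _

/-! ### Plurisubharmonic functions and the maximum principle. -/

section PSH

variable {n : ℕ} {D : Set (EuclideanSpace ℂ (Fin n))}

lemma ContinuousOn.continuous_circle {h : EuclideanSpace ℂ (Fin n) → ℝ} (hh : ContinuousOn h D)
    {a b : EuclideanSpace ℂ (Fin n)} (hab : ∀ ζ : ℂ, ‖ζ‖ ≤ 1 → a + ζ • b ∈ D) :
    Continuous fun θ : ℝ => h (a + Complex.exp (θ * Complex.I) • b) :=
  hh.comp_continuous (by fun_prop) fun θ => hab _ (Complex.norm_exp_ofReal_mul_I θ).le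

lemma isContPSH_iff {h : EuclideanSpace ℂ (Fin n) → ℝ} :
    IsContPSH D h ↔ ContinuousOn h (closure D) ∧ ∀ a ∈ D, ∀ b : EuclideanSpace ℂ (Fin n),
      (∀ ζ : ℂ, ‖ζ‖ ≤ 1 → a + ζ • b ∈ D) →
        h a ≤ ∫ θ : ℝ, h (a + Complex.exp (θ * Complex.I) • b) ∂angularMeasure := by
  refine ⟨fun ⟨hc, hp⟩ => ⟨hc, fun a ha b hab => ?_⟩, fun ⟨hc, hp⟩ => ⟨hc, ?_, ?_, ?_⟩⟩
  · have := hp.le_mean a ha b hab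
    rwa [angularMean_coe ((hc.mono subset_closure).continuous_circle hab).integrable_angularMeasure,
      EReal.coe_le_coe_iff] at this
  · exact fun z _ => EReal.coe_lt_top _
  · exact (continuous_coe_real_ereal.comp_continuousOn (hc.mono subset_closure)).upperSemicontinuousOn
  · intro a ha b hab
    rw [angularMean_coe ((hc.mono subset_closure).continuous_circle hab).integrable_angularMeasure,
      EReal.coe_le_coe_iff]
    exact hp a ha b hab

lemma IsContPSH.add {h k : EuclideanSpace ℂ (Fin n) → ℝ} (hh : IsContPSH D h)
    (hk : IsContPSH D k) : IsContPSH D fun z => h z + k z := by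
  rw [isContPSH_iff] at *
  refine ⟨hh.1.add hk.1, fun a ha b hab => ?_⟩
  rw [integral_add ((hh.1.mono subset_closure).continuous_circle hab).integrable_angularMeasure
    ((hk.1.mono subset_closure).continuous_circle hab).integrable_angularMeasure]
  exact add_le_add (hh.2 a ha b hab) (hk.2 a ha b hab)

lemma IsContPSH.const_mul {h : EuclideanSpace ℂ (Fin n) → ℝ} (hh : IsContPSH D h) {c : ℝ}
    (hc : 0 ≤ c) : IsContPSH D fun z => c * h z := by
  rw [isContPSH_iff] at *
  refine ⟨continuousOn_const.mul hh.1, fun a ha b hab => ?_⟩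
  rw [integral_const_mul]
  exact mul_le_mul_of_nonneg_left (hh.2 a ha b hab) hc

lemma isContPSH_const (c : ℝ) : IsContPSH D fun _ => c := by
  rw [isContPSH_iff]
  exact ⟨continuousOn_const, fun a _ b _ => by simp⟩

lemma isContPSH_posLog_inner (e p : EuclideanSpace ℂ (Fin n)) :
    IsContPSH D fun z => Real.posLog ‖inner ℂ e (z - p)‖ := by
  rw [isContPSH_iff]
  refine ⟨(Real.continuous_posLog.comp (by fun_prop)).continuousOn, fun a _ b _ => ?_⟩
  have := posLog_norm_le_integral (inner ℂ e (a - p)) (inner ℂ e b)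
  simpa only [add_sub_right_comm _ _ p, inner_add_right, inner_smul_right] using this

/-- Closed discs with a small radius vector stay in an open set. -/
lemma IsOpen.exists_disc_subset (hD : IsOpen D) {a : EuclideanSpace ℂ (Fin n)} (ha : a ∈ D) :
    ∃ r > 0, ∀ z w : EuclideanSpace ℂ (Fin n), dist z a < r → dist w a < r → ∀ ζ : ℂ, ‖ζ‖ ≤ 1 →
      z + ζ • (w - z) ∈ D := by
  obtain ⟨r, hr, hrD⟩ := Metric.isOpen_iff.1 hD a ha
  refine ⟨r / 3, by positivity, fun z w hz hw ζ hζ => hrD ?_⟩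
  rw [Metric.mem_ball, dist_eq_norm]
  rw [dist_eq_norm] at hz hw
  have h1 : z + ζ • (w - z) - a = (z - a) + ζ • ((w - a) - (z - a)) := by
    rw [sub_sub_sub_cancel_right]; abel
  have h2 : ‖ζ • ((w - a) - (z - a))‖ ≤ ‖w - a‖ + ‖z - a‖ := by
    rw [norm_smul]
    exact (mul_le_of_le_one_left (norm_nonneg _) hζ).trans (norm_sub_le _ _)
  rw [h1]
  have := norm_add_le (z - a) (ζ • ((w - a) - (z - a)))
  linarith

/-- If the bound fails, the boundary condition confines the set where `u + h` is at least some `η >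
0` to a compact subset of `D`, so `u + h` has a maximum at some `a`. There the sub-mean inequality
for `u` contradicts the strict one for `h`. -/
lemma IsPSH.le_neg_of_strict [Nontrivial (EuclideanSpace ℂ (Fin n))] (hD : IsOpen D)
    (hDb : Bornology.IsBounded D) {u : EuclideanSpace ℂ (Fin n) → EReal} (hu : IsPSH D u)
    {h : EuclideanSpace ℂ (Fin n) → ℝ} (hh : ContinuousOn h (closure D))
    (hstrict : ∀ a ∈ D, ∀ b : EuclideanSpace ℂ (Fin n), b ≠ 0 →
      (∀ ζ : ℂ, ‖ζ‖ ≤ 1 → a + ζ • b ∈ D) →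
        h a < ∫ θ : ℝ, h (a + Complex.exp (θ * Complex.I) • b) ∂angularMeasure)
    (hbd : ∀ ζ ∈ frontier D, upperReg D u ζ ≤ ((-h ζ : ℝ) : EReal)) :
    ∀ z ∈ D, u z ≤ ((-h z : ℝ) : EReal) := by
  by_contra! hcon
  obtain ⟨z₀, hz₀, hz₀u⟩ := hcon
  obtain ⟨t, ht1, ht2⟩ := EReal.lt_iff_exists_real_btwn.1 hz₀u
  have ht1 : -h z₀ < t := EReal.coe_lt_coe_iff.1 ht1
  set η : ℝ := t + h z₀ with hη
  have hη0 : 0 < η := by linarith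
  have husc : UpperSemicontinuousOn (fun z => u z + (h z : EReal)) D := by
    intro a ha
    have hca : ContinuousWithinAt (fun z => (h z : EReal)) D a :=
      (continuous_coe_real_ereal.comp_continuousOn (hh.mono subset_closure)) a ha
    exact UpperSemicontinuousWithinAt.add' (hu.usc a ha) hca.upperSemicontinuousWithinAt
      (EReal.continuousAt_add (Or.inr (EReal.coe_ne_bot _)) (Or.inr (EReal.coe_ne_top _)))
  set K := {z ∈ D | (η : EReal) ≤ u z + (h z : EReal)} with hK
  have hKne : z₀ ∈ K := by
    refine ⟨hz₀, ?_⟩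
    rw [hη, EReal.coe_add]
    exact add_le_add_left ht2.le _
  have hKcl : IsClosed K := by
    rw [← closure_subset_iff_isClosed]
    intro ζ hζ
    have hζD : ζ ∈ closure D := closure_mono (fun z hz => hz.1) hζ
    have hfreq : ∃ᶠ z in 𝓝[D] ζ, (η : EReal) ≤ u z + (h z : EReal) := by
      rw [frequently_nhdsWithin_iff]
      exact (mem_closure_iff_frequently.1 hζ).mono fun z hz => ⟨hz.2, hz.1⟩
    by_cases hζ' : ζ ∈ D
    · refine ⟨hζ', ?_⟩
      by_contra! hlt
      exact hfreq ((husc ζ hζ' _ hlt).mono fun z hz => not_le.2 hz)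
    · exfalso
      have hζf : ζ ∈ frontier D := by rw [hD.frontier_eq]; exact ⟨hζD, hζ'⟩
      have h1 : ∀ᶠ z in 𝓝[D] ζ, u z < ((-h ζ + η / 2 : ℝ) : EReal) :=
        eventually_lt_of_limsup_lt ((hbd ζ hζf).trans_lt (EReal.coe_lt_coe_iff.2 (by linarith)))
      have h2 : ∀ᶠ z in 𝓝[D] ζ, h z < h ζ + η / 2 :=
        ((hh ζ hζD).mono subset_closure).eventually_lt_const (by linarith)
      refine hfreq ?_
      filter_upwards [h1, h2] with z hz1 hz2
      rw [not_le]
      calc u z + (h z : EReal) ≤ ((-h ζ + η / 2 : ℝ) : EReal) + (h z : EReal) :=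
            add_le_add_left hz1.le _
        _ < (η : EReal) := by
            rw [← EReal.coe_add, EReal.coe_lt_coe_iff]; linarith
  have hKc : IsCompact K :=
    Metric.isCompact_of_isClosed_isBounded hKcl (hDb.subset fun z hz => hz.1)
  obtain ⟨a, haK, hmax⟩ := (husc.mono fun z hz => hz.1 : UpperSemicontinuousOn _ K).exists_isMaxOn
    ⟨z₀, hKne⟩ hKc
  have haD := haK.1
  have huatop : u a ≠ ⊤ := (hu.lt_top a haD).ne
  have huabot : u a ≠ ⊥ := by
    intro hb
    have := haK.2
    rw [hb, EReal.bot_add] at this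
    exact (EReal.bot_lt_coe η).not_ge this
  lift u a to ℝ using ⟨huatop, huabot⟩ with s hs
  have hsη : η ≤ s + h a := by
    have := haK.2
    rwa [← hs, ← EReal.coe_add, EReal.coe_le_coe_iff] at this
  have hle : ∀ z ∈ D, u z ≤ ((s + h a - h z : ℝ) : EReal) := by
    intro z hz
    rw [EReal.coe_sub, EReal.le_sub_iff_add_le (Or.inl (EReal.coe_ne_bot _))
      (Or.inl (EReal.coe_ne_top _))]
    by_cases hzK : z ∈ K
    · have := hmax hzK
      simp only [mem_ofPred_eq] at this
      rwa [← hs, ← EReal.coe_add] at this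
    · refine (not_le.1 fun hc => hzK ⟨hz, hc⟩).le.trans ?_
      exact EReal.coe_le_coe_iff.2 hsη
  obtain ⟨r, hr, hdisc⟩ := hD.exists_disc_subset haD
  obtain ⟨w, hw, hwa⟩ : ∃ w ∈ Metric.ball a r, w ≠ a := by
    have : (𝓝[≠] a).NeBot := Module.punctured_nhds_neBot ℂ _ a
    obtain ⟨w, hw⟩ := (inter_mem_nhdsWithin {a}ᶜ (Metric.ball_mem_nhds a hr) |>
      this.nonempty_of_mem)
    exact ⟨w, hw.2, hw.1⟩
  have hd := hdisc a w (by simpa using hr) hw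
  have hcont := ((hh.mono subset_closure).continuous_circle hd).integrable_angularMeasure
  have hmean := (hu.le_mean a haD _ hd).trans (angularMean_le_integral
    (q := fun θ => s + h a - h (a + Complex.exp (θ * Complex.I) • (w - a)))
    ((integrable_const _).sub hcont)
    fun θ => hle _ (hd _ (Complex.norm_exp_ofReal_mul_I θ).le))
  rw [← hs, EReal.coe_le_coe_iff, integral_sub (integrable_const _) hcont] at hmean
  have := hstrict a haD _ (sub_ne_zero.2 hwa) hd
  simp at hmean
  linarith

/-- Maximum principle: boundary domination `u^* ≤ -h` propagates to the domain. -/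
lemma IsPSH.le_neg_of_upperReg_le [Nontrivial (EuclideanSpace ℂ (Fin n))] (hD : IsOpen D)
    (hDb : Bornology.IsBounded D) {u : EuclideanSpace ℂ (Fin n) → EReal} (hu : IsPSH D u)
    {h : EuclideanSpace ℂ (Fin n) → ℝ} (hh : IsContPSH D h)
    (hbd : ∀ ζ ∈ frontier D, upperReg D u ζ ≤ ((-h ζ : ℝ) : EReal)) :
    ∀ z ∈ D, u z ≤ ((-h z : ℝ) : EReal) := by
  obtain ⟨R, hR⟩ := hDb.closure.exists_norm_le
  have hR0 : ∀ z ∈ closure D, ‖z‖ ^ 2 ≤ R ^ 2 := fun z hz => by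
    have := hR z hz
    gcongr
  obtain ⟨hc, hm⟩ := isContPSH_iff.1 hh
  -- The added term is strictly plurisubharmonic and non-positive on `closure D`, so it supplies
  -- strictness without spoiling the boundary bound.
  have key : ∀ ε > 0, ∀ z ∈ D, u z ≤ ((-(h z + ε * (‖z‖ ^ 2 - R ^ 2)) : ℝ) : EReal) := by
    intro ε hε
    refine hu.le_neg_of_strict hD hDb (h := fun z => h z + ε * (‖z‖ ^ 2 - R ^ 2))
      (by fun_prop) ?_ ?_
    · intro a ha b hb hab
      have hi := ((hc.mono subset_closure).continuous_circle hab).integrable_angularMeasure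
      have hj : Integrable (fun θ : ℝ => ‖a + Complex.exp (θ * Complex.I) • b‖ ^ 2)
          angularMeasure := Continuous.integrable_angularMeasure (by fun_prop)
      have hk : Integrable (fun θ : ℝ => ‖a + Complex.exp (θ * Complex.I) • b‖ ^ 2 - R ^ 2)
          angularMeasure := hj.sub (integrable_const _)
      rw [integral_add hi (hk.const_mul _), integral_const_mul,
        integral_sub hj (integrable_const _), integral_norm_add_circle_sq]
      have h1 := hm a ha b hab
      have h2 : 0 < ε * ‖b‖ ^ 2 := by positivity
      simp only [integral_const, probReal_univ, one_smul]
      linarith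
    · intro ζ hζ
      refine (hbd ζ hζ).trans (EReal.coe_le_coe_iff.2 ?_)
      have := hR0 ζ (frontier_subset_closure hζ)
      nlinarith
  intro z hz
  refine EReal.le_of_forall_lt_iff_le.1 fun t ht => ?_
  have ht : -h z < t := EReal.coe_lt_coe_iff.1 ht
  have hz2 := hR0 z (subset_closure hz)
  obtain ⟨ε, hε, hε2⟩ : ∃ ε > 0, ε * (R ^ 2 - ‖z‖ ^ 2) < t + h z :=
    (exists_pos_mul_lt (by linarith : 0 < t + h z) (R ^ 2 - ‖z‖ ^ 2)).imp
      fun ε h => ⟨h.1, by simpa only [mul_comm ε] using h.2⟩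
  refine (key ε hε z hz).trans (EReal.coe_le_coe_iff.2 ?_)
  linarith

end PSH

/-! ### Two-constants estimates and negativity of the extremal function. -/

section Extremal

variable {n : ℕ} {D : Set (EuclideanSpace ℂ (Fin n))}

lemma angularMeasure_real_Ioc_pos {t : ℝ} (ht : 0 < t) : 0 < angularMeasure.real (Ioc 0 t) := by
  have hpi : (0 : ℝ) < 2 * Real.pi := by positivity
  rw [measureReal_def, ENNReal.toReal_pos_iff]
  refine ⟨?_, measure_lt_top _ _⟩
  rw [angularMeasure, Measure.smul_apply, Measure.restrict_apply measurableSet_Ioc, Ioc_inter_Ioc,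
    Real.volume_Ioc, smul_eq_mul]
  refine ENNReal.mul_pos ?_ ?_
  · simpa using hpi
  · simpa using ⟨ht, Real.pi_pos⟩

/-- A negative upper bound on an open subset propagates to every point of a connected domain, with
a factor independent of the non-positive plurisubharmonic function. -/
lemma exists_pos_forall_le_of_le_on (hD : IsOpen D) (hDc : IsPreconnected D)
    {N : Set (EuclideanSpace ℂ (Fin n))} (hN : IsOpen N) (hND : (D ∩ N).Nonempty) :
    ∀ z ∈ D, ∃ δ > 0, ∀ u, IsNonposPSH D u → ∀ c : ℝ, 0 ≤ c →
      (∀ w ∈ D ∩ N, u w ≤ ((-c : ℝ) : EReal)) → u z ≤ ((-(δ * c) : ℝ) : EReal) := by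
  -- Points near which one `δ` works uniformly. The local uniformity makes `P` open; the rest shows
  -- that `P` is closed relative to `D`.
  let P : Set (EuclideanSpace ℂ (Fin n)) := {a | ∃ δ > 0, ∀ᶠ z in 𝓝 a, z ∈ D → ∀ u,
    IsNonposPSH D u → ∀ c : ℝ, 0 ≤ c → (∀ w ∈ D ∩ N, u w ≤ ((-c : ℝ) : EReal)) →
      u z ≤ ((-(δ * c) : ℝ) : EReal)}
  have hPo : IsOpen P := by
    rw [isOpen_iff_mem_nhds]
    rintro a ⟨δ, hδ, ha⟩
    filter_upwards [ha.eventually_nhds] with z hz using ⟨δ, hδ, hz⟩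
  have hNP : (D ∩ P).Nonempty := by
    obtain ⟨w, hwD, hwN⟩ := hND
    refine ⟨w, hwD, 1, one_pos, ?_⟩
    filter_upwards [hN.mem_nhds hwN] with z hzN hzD u _ c _ h
    simpa using h z ⟨hzD, hzN⟩
  suffices hDP : D ⊆ P by
    intro z hz
    obtain ⟨δ, hδ, h⟩ := hDP hz
    exact ⟨δ, hδ, h.self_of_nhds hz⟩
  refine hDc.subset_of_closure_inter_subset hPo hNP ?_
  rintro a ⟨haP, haD⟩
  obtain ⟨r, hr, hdisc⟩ := hD.exists_disc_subset haD
  obtain ⟨w, hwP, hwa⟩ := Metric.mem_closure_iff.1 haP r hr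
  rw [dist_comm] at hwa
  obtain ⟨δ, hδ, hw⟩ := hwP
  -- The circle about `z` with radius vector `w - z` passes through `w` at `θ = 0`. For `z` near
  -- `a`, a short arc therefore stays near `w ∈ P`, and its angular measure is the factor lost.
  have hcont : Tendsto (fun p : EuclideanSpace ℂ (Fin n) × ℝ =>
      p.1 + Complex.exp (p.2 * Complex.I) • (w - p.1)) (𝓝 (a, 0)) (𝓝 w) := by
    have : Continuous fun p : EuclideanSpace ℂ (Fin n) × ℝ =>
      p.1 + Complex.exp (p.2 * Complex.I) • (w - p.1) := by fun_prop
    simpa using this.tendsto (a, 0)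
  have hev := hcont.eventually hw
  rw [nhds_prod_eq] at hev
  obtain ⟨pa, hpa, pb, hpb, hab⟩ := eventually_prod_iff.1 hev
  obtain ⟨t, ht, htb⟩ := Metric.eventually_nhds_iff.1 hpb
  have ht2 : 0 < t / 2 := by positivity
  refine ⟨δ * angularMeasure.real (Ioc 0 (t / 2)), mul_pos hδ (angularMeasure_real_Ioc_pos ht2), ?_⟩
  filter_upwards [hpa, Metric.ball_mem_nhds a hr] with z hz hzr hzD u hu c hc huN
  have hd := hdisc z w hzr hwa
  have hmean := (hu.1.le_mean z hzD _ hd).trans (angularMean_le_integral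
    (q := (Ioc 0 (t / 2)).indicator fun _ => -(δ * c))
    ((integrable_const _).indicator measurableSet_Ioc) fun θ => ?_)
  · rw [integral_indicator_const _ measurableSet_Ioc] at hmean
    refine hmean.trans_eq ?_
    rw [smul_eq_mul]
    congr 1
    ring
  · have hθD := hd _ (Complex.norm_exp_ofReal_mul_I θ).le
    by_cases hθ : θ ∈ Ioc 0 (t / 2)
    · rw [indicator_of_mem hθ]
      refine hab hz (htb ?_) hθD u hu c hc huN
      rw [Real.dist_eq, sub_zero, abs_of_pos hθ.1]
      linarith [hθ.2]
    · rw [indicator_of_notMem hθ]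
      exact hu.2 _ hθD

lemma IsBRegular.exists_bump (hreg : IsBRegular D) {O : Set (EuclideanSpace ℂ (Fin n))}
    (hO : IsOpen O) {ζ : EuclideanSpace ℂ (Fin n)} (hζO : ζ ∈ O) (hζ : ζ ∈ frontier D) :
    ∃ h, IsContPSH D h ∧ h ζ = 1 ∧ (∀ z ∈ frontier D, h z ≤ 1) ∧
      ∀ z ∈ frontier D, z ∉ O → h z = 0 := by
  obtain ⟨r, hr, hrO⟩ := Metric.isOpen_iff.1 hO ζ hζO
  obtain ⟨h, hh, hφ⟩ := hreg (fun z => max 0 (1 - dist z ζ / r)) (by fun_prop)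
  refine ⟨h, hh, ?_, fun z hz => ?_, fun z hz hzO => ?_⟩
  · simp [hφ hζ]
  · rw [hφ hz]
    have : 0 ≤ dist z ζ / r := by positivity
    exact max_le zero_le_one (by linarith)
  · have : r ≤ dist z ζ := by
      by_contra! hlt
      exact hzO (hrO hlt)
    have : 1 ≤ dist z ζ / r := by rwa [one_le_div hr]
    rw [hφ hz]
    exact max_eq_left (by linarith)

lemma IsNonposPSH.upperReg_nonpos {u : EuclideanSpace ℂ (Fin n) → EReal} (hu : IsNonposPSH D u)
    (ζ : EuclideanSpace ℂ (Fin n)) : upperReg D u ζ ≤ 0 :=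
  limsup_le_of_le (h := eventually_nhdsWithin_of_forall hu.2)

/-- Quantitative two-constants estimate: a bound `u^* ≤ -c` on a relatively open piece of the
boundary of a B-regular domain gives `u(z) ≤ -δ c` with `δ > 0` independent of `u`. -/
lemma IsBRegular.exists_pos_forall_le (hD : IsOpen D) (hDc : IsPreconnected D)
    (hDb : Bornology.IsBounded D) (hreg : IsBRegular D)
    {O : Set (EuclideanSpace ℂ (Fin n))} (hO : IsOpen O) (hne : (O ∩ frontier D).Nonempty)
    {z : EuclideanSpace ℂ (Fin n)} (hz : z ∈ D) :
    ∃ δ > 0, ∀ u, IsNonposPSH D u → ∀ c : ℝ, 0 ≤ c →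
      (∀ ζ ∈ O ∩ frontier D, upperReg D u ζ ≤ ((-c : ℝ) : EReal)) →
        u z ≤ ((-(δ * c) : ℝ) : EReal) := by
  obtain ⟨ζ, hζO, hζ⟩ := hne
  have : Nontrivial (EuclideanSpace ℂ (Fin n)) :=
    ⟨z, ζ, fun h => disjoint_left.1 (disjoint_iff_inter_eq_empty.2 hD.inter_frontier_eq) hz (h ▸ hζ)⟩
  obtain ⟨h, hh, hζ1, hle, hzero⟩ := hreg.exists_bump hO hζO hζ
  have hζcl := frontier_subset_closure hζ
  obtain ⟨r, hr, hrh⟩ := Metric.mem_nhdsWithin_iff.1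
    ((hh.1 ζ hζcl).eventually_const_lt (by rw [hζ1]; norm_num : (1 / 2 : ℝ) < h ζ))
  obtain ⟨w, hwD, hwr⟩ := Metric.mem_closure_iff.1 hζcl r hr
  rw [dist_comm] at hwr
  obtain ⟨δ, hδ, H⟩ := exists_pos_forall_le_of_le_on hD hDc (Metric.isOpen_ball (x := ζ) (ε := r))
    ⟨w, hwD, hwr⟩ z hz
  refine ⟨δ * (1 / 2), by positivity, fun u hu c hc huV => ?_⟩
  -- The bump, scaled by `c`, dominates on the whole boundary: on `O` because `h ≤ 1`, elsewhere
  -- because `h = 0` and `u ≤ 0`.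
  have hdom := hu.1.le_neg_of_upperReg_le hD hDb (hh.const_mul hc) fun ξ hξ => ?_
  · have := H u hu (c * (1 / 2)) (by positivity) fun x hx => (hdom x hx.1).trans <| by
      have : 1 / 2 < h x := hrh ⟨hx.2, subset_closure hx.1⟩
      rw [EReal.coe_le_coe_iff]
      gcongr
    rwa [show δ * (1 / 2) * c = δ * (c * (1 / 2)) by ring]
  · by_cases hξO : ξ ∈ O
    · refine (huV ξ ⟨hξO, hξ⟩).trans (EReal.coe_le_coe_iff.2 ?_)
      exact neg_le_neg (mul_le_of_le_one_right hc (hle ξ hξ))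
    · rw [hzero ξ hξ hξO]
      simpa using hu.upperReg_nonpos ξ

lemma IsBRegular.not_isBPluripolar (hD : IsOpen D) (hDc : IsPreconnected D)
    (hDb : Bornology.IsBounded D) (hreg : IsBRegular D)
    {O : Set (EuclideanSpace ℂ (Fin n))} (hO : IsOpen O) (hne : (O ∩ frontier D).Nonempty) :
    ¬ IsBPluripolar D (O ∩ frontier D) := by
  rintro ⟨u, hu, ⟨z, hz, hzu⟩, hV⟩
  obtain ⟨δ, hδ, H⟩ := hreg.exists_pos_forall_le hD hDc hDb hO hne hz
  refine hzu (EReal.eq_bot_iff_forall_lt _ |>.2 fun y => ?_)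
  -- This `c` makes the bound equal to `-|y - 1|`, which is below `y`.
  have := H u hu (|y - 1| / δ) (by positivity) fun ζ hζ => by rw [hV ζ hζ]; exact bot_le
  refine this.trans_lt (EReal.coe_lt_coe_iff.2 ?_)
  rw [mul_div_cancel₀ _ hδ.ne']
  linarith [neg_abs_le (y - 1)]

lemma IsBRegular.boundaryExtremal_neg (hD : IsOpen D) (hDc : IsPreconnected D)
    (hDb : Bornology.IsBounded D) (hreg : IsBRegular D)
    {O : Set (EuclideanSpace ℂ (Fin n))} (hO : IsOpen O) (hne : (O ∩ frontier D).Nonempty)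
    {z : EuclideanSpace ℂ (Fin n)} (hz : z ∈ D) :
    boundaryExtremal (O ∩ frontier D) D z < 0 := by
  obtain ⟨δ, hδ, H⟩ := hreg.exists_pos_forall_le hD hDc hDb hO hne hz
  refine lt_of_le_of_lt (sSup_le ?_) (EReal.coe_lt_coe_iff.2 (neg_lt_zero.2 hδ))
  rintro _ ⟨u, hu, huV, rfl⟩
  simpa using H u hu 1 zero_le_one fun ζ hζ => by simpa using huV ζ hζ

end Extremal

/-! ### The discrete set accumulating exactly on the closure of `V`. -/

section DiscreteApprox

variable {n : ℕ} {D V L : Set (EuclideanSpace ℂ (Fin n))}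

lemma disjoint_closure_of_subset_frontier (hD : IsOpen D) (hV : V ⊆ frontier D) :
    Disjoint D (closure V) :=
  (disjoint_iff_inter_eq_empty.2 hD.inter_frontier_eq).mono_right (closure_minimal hV isClosed_frontier)

/-- Run through a dense sequence of `V` so that each term recurs infinitely often (via
`Nat.unpair`), and at stage `m` pick a point of `D` within `1 / (m + 1)`. The recurrence yields
density at `V`; the shrinking distances prevent accumulation off `closure V`. -/
lemma exists_isDiscreteApprox (hD : IsOpen D) (hDb : Bornology.IsBounded D)
    (hV : V ⊆ frontier D) (hne : V.Nonempty) : ∃ L, IsDiscreteApprox D V L := by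
  have : Nonempty V := hne.to_subtype
  obtain ⟨v, hv⟩ := TopologicalSpace.exists_dense_seq V
  have hz : ∀ m : ℕ, ∃ z ∈ D, dist (v m.unpair.1 : EuclideanSpace ℂ (Fin n)) z < 1 / ((m : ℝ) + 1) :=
    fun m => Metric.mem_closure_iff.1 (frontier_subset_closure (hV (v m.unpair.1).2)) _ (by positivity)
  choose z hzD hzv using hz
  have hfin : ∀ a ∉ closure V, ∃ ε > 0, (Metric.ball a ε ∩ range z).Finite := by
    intro a ha
    rw [Metric.mem_closure_iff] at ha
    push Not at ha
    obtain ⟨ε, hε, haV⟩ := ha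
    refine ⟨ε / 2, by positivity, ?_⟩
    have hev : ∀ᶠ m : ℕ in cofinite, 1 / ((m : ℝ) + 1) < ε / 2 := by
      rw [Nat.cofinite_eq_atTop]
      exact tendsto_one_div_add_atTop_nhds_zero_nat.eventually_lt_const (by positivity)
    refine (Set.Finite.image z (eventually_cofinite.1 hev)).subset ?_
    rintro _ ⟨hm, m, rfl⟩
    refine ⟨m, fun hlt => ?_, rfl⟩
    have h1 := haV _ (v m.unpair.1).2
    have h2 := dist_triangle_left a (v m.unpair.1 : EuclideanSpace ℂ (Fin n)) (z m)
    have h3 := hzv m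
    rw [dist_comm] at h3
    rw [Metric.mem_ball] at hm
    linarith
  have hVL : V ⊆ closure (range z) := by
    have h1 : V ⊆ closure (range fun k => (v k : EuclideanSpace ℂ (Fin n))) := by
      intro x hx
      have := image_closure_subset_closure_image continuous_subtype_val
        (mem_image_of_mem _ (hv ⟨x, hx⟩))
      rwa [← range_comp] at this
    refine h1.trans (closure_minimal ?_ isClosed_closure)
    rintro _ ⟨k, rfl⟩
    rw [Metric.mem_closure_range_iff]
    intro ε hε
    obtain ⟨j, hj⟩ := exists_nat_one_div_lt hε
    refine ⟨Nat.pair k j, ?_⟩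
    have := hzv (Nat.pair k j)
    rw [Nat.unpair_pair] at this
    refine (this.trans_le ?_).trans hj
    have : (j : ℝ) ≤ Nat.pair k j := by exact_mod_cast Nat.right_le_pair k j
    gcongr
  have hLD : range z ⊆ D := by
    rintro _ ⟨m, rfl⟩
    exact hzD m
  refine ⟨range z, hLD, range_nonempty z, countable_range z, ?_, ?_, ?_⟩
  · refine Subset.antisymm (fun a ha => ?_)
      (union_subset subset_closure (closure_minimal hVL isClosed_closure))
    by_contra hcon
    obtain ⟨haL, haV⟩ := not_or.1 hcon
    obtain ⟨ε, hε, hf⟩ := hfin a haV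
    have := mem_closure_iff_nhds.1 ha _ (inter_mem (Metric.ball_mem_nhds a hε)
      (hf.isClosed.isOpen_compl.mem_nhds fun h => haL h.2))
    obtain ⟨y, ⟨hy1, hy2⟩, hy3⟩ := this
    exact hy2 ⟨hy1, hy3⟩
  · exact Metric.isCompact_of_isClosed_isBounded isClosed_closure (hDb.subset hLD).closure
  · intro a ha hacc
    obtain ⟨ε, hε, hf⟩ := hfin a fun h =>
      disjoint_left.1 (disjoint_closure_of_subset_frontier hD hV) ha h
    obtain ⟨y, ⟨⟨hy1, hy2⟩, hy3⟩, hya⟩ := accPt_iff_nhds.1 hacc _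
      (inter_mem (Metric.ball_mem_nhds a hε)
        ((hf.subset (sdiff_subset (t := {a}))).isClosed.isOpen_compl.mem_nhds fun h => h.2 rfl))
    exact hy2 ⟨⟨hy1, hy3⟩, hya⟩

lemma abs_negChar_le (x : D) : |negChar D L x| ≤ 1 := by
  by_cases hx : (x : EuclideanSpace ℂ (Fin n)) ∈ L <;> simp [negChar, hx]

lemma measurable_negChar (hL : L.Countable) : Measurable (negChar D L) :=
  ((measurable_const.indicator hL.measurableSet).comp measurable_subtype_coe).neg

/-- `L` is relatively closed in `D`, since `closure V` lies in the boundary. -/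
lemma IsDiscreteApprox.lowerSemicontinuous_negChar (hD : IsOpen D) (hV : V ⊆ frontier D)
    (hL : IsDiscreteApprox D V L) : LowerSemicontinuous (negChar D L) := by
  intro x y hy
  by_cases hx : (x : EuclideanSpace ℂ (Fin n)) ∈ L
  · refine Eventually.of_forall fun w => hy.trans_le ?_
    have := neg_le_of_abs_le (abs_negChar_le (L := L) w)
    simpa [negChar, hx] using this
  · have hxc : (x : EuclideanSpace ℂ (Fin n)) ∉ closure L := by
      rw [hL.closure_eq]
      exact not_or.2 ⟨hx, disjoint_left.1 (disjoint_closure_of_subset_frontier hD hV) x.2⟩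
    have hev : ∀ᶠ w : D in 𝓝 x, (w : EuclideanSpace ℂ (Fin n)) ∈ (closure L)ᶜ :=
      continuousAt_subtype_val.eventually (isClosed_closure.isOpen_compl.mem_nhds hxc)
    filter_upwards [hev] with w hw
    have hwL : (w : EuclideanSpace ℂ (Fin n)) ∉ L := fun h => hw (subset_closure h)
    simpa [negChar, hwL, hx] using hy

lemma IsDiscreteApprox.exists_notMem [Nontrivial (EuclideanSpace ℂ (Fin n))] (hD : IsOpen D)
    (hne : D.Nonempty) (hL : IsDiscreteApprox D V L) :
    ∃ z : D, (z : EuclideanSpace ℂ (Fin n)) ∉ L := by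
  by_contra! hcon
  obtain ⟨a, ha⟩ := hne
  have : (𝓝[≠] a).NeBot := Module.punctured_nhds_neBot ℂ _ a
  refine hL.no_acc a ha (accPt_iff_nhds.2 fun U hU => ?_)
  obtain ⟨y, hya, hyU, hyD⟩ :=
    this.nonempty_of_mem (inter_mem_nhdsWithin {a}ᶜ (inter_mem hU (hD.mem_nhds ha)))
  exact ⟨y, ⟨hyU, hcon ⟨y, hyD⟩⟩, hya⟩

end DiscreteApprox

/-! ### Jensen measures and the two envelopes. -/

section Edwards

variable {n : ℕ} {D V L : Set (EuclideanSpace ℂ (Fin n))}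

/-- The cone of restrictions to `D` of functions in `PSH(D) ∩ C(closure D)`. -/
def contPSHCone (D : Set (EuclideanSpace ℂ (Fin n))) : ConvexCone ℝ C(D, ℝ) where
  carrier := {f | ∃ h, IsContPSH D h ∧ ∀ x : D, f x = h x}
  smul_mem' := by
    rintro c hc f ⟨h, hh, hf⟩
    exact ⟨_, hh.const_mul hc.le, fun x => by simp [hf]⟩
  add_mem' := by
    rintro f ⟨h, hh, hf⟩ g ⟨k, hk, hg⟩
    exact ⟨_, hh.add hk, fun x => by simp [hf, hg]⟩

lemma mem_contPSHCone {f : C(D, ℝ)} :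
    f ∈ contPSHCone D ↔ ∃ h, IsContPSH D h ∧ ∀ x : D, f x = h x := Iff.rfl

lemma const_mem_contPSHCone (c : ℝ) : ContinuousMap.const D c ∈ contPSHCone D :=
  ⟨_, isContPSH_const c, fun _ => rfl⟩

/-- Jensen measures do not charge points other than their barycentre. -/
lemma jensenMeasures_singleton_eq_zero (hDb : Bornology.IsBounded D) {z p : D} (hzp : p ≠ z)
    {μ : Measure D} (hμ : μ ∈ jensenMeasures (contPSHCone D) z) : μ {p} = 0 := by
  obtain ⟨hprob, -, hJ⟩ := hμ
  set e : EuclideanSpace ℂ (Fin n) := z - p with he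
  have he0 : e ≠ 0 := sub_ne_zero.2 fun h => hzp (Subtype.ext h.symm)
  set A : ℝ := ‖inner ℂ e e‖ with hA
  have hA0 : 0 < A := norm_pos_iff.2 (inner_self_ne_zero.2 he0)
  obtain ⟨R, hR⟩ := hDb.exists_norm_le
  have hR0 : 0 ≤ R := (norm_nonneg _).trans (hR z z.2)
  set B : ℝ := ‖e‖ * (R + R) with hB
  have hB0 : 0 ≤ B := by positivity
  set P : ℝ := μ.real {p} with hP
  have hP0 : 0 ≤ P := measureReal_nonneg
  -- With `c = exp t`, the Jensen inequality reads `t + log A ≤ (t + log⁺ B) (1 - P)`: the test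
  -- function vanishes at `p` and is at most `t + log⁺ B` elsewhere.
  have key : ∀ t : ℝ, 0 ≤ t → t * P ≤ Real.posLog B - Real.log A := by
    intro t ht
    set c : ℝ := Real.exp t with hc
    have hc0 : 0 < c := Real.exp_pos t
    set f : EuclideanSpace ℂ (Fin n) → ℝ :=
      fun w => Real.posLog ‖inner ℂ ((c : ℂ) • e) (w - p)‖ with hf
    have hfeq : ∀ w, f w = Real.posLog (c * ‖inner ℂ e (w - p)‖) := by
      intro w
      simp only [hf, inner_smul_left, norm_mul, Complex.conj_ofReal, Complex.norm_real,
        Real.norm_of_nonneg hc0.le]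
    have hfc : Continuous f := Real.continuous_posLog.comp (by fun_prop)
    have hub : ∀ w ∈ D, f w ≤ t + Real.posLog B := by
      intro w hw
      have h1 : ‖inner ℂ e (w - p)‖ ≤ B :=
        (norm_inner_le_norm _ _).trans (mul_le_mul_of_nonneg_left
          ((norm_sub_le _ _).trans (add_le_add (hR w hw) (hR p p.2))) (norm_nonneg _))
      rw [hfeq]
      refine Real.posLog_mul.trans (add_le_add ?_ (Real.posLog_le_posLog (norm_nonneg _) h1))
      rw [Real.posLog_apply, hc, Real.log_exp, max_eq_right ht]
    have hlb : t + Real.log A ≤ f z := by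
      rw [hfeq, Real.posLog_apply]
      refine le_trans (le_of_eq ?_) (le_max_right _ _)
      rw [Real.log_mul hc0.ne' (by rw [← he]; exact hA0.ne'), hc, Real.log_exp]
    have hfp : f p = 0 := by simp [hf]
    have hJf := hJ ⟨fun x => f x, hfc.comp continuous_subtype_val⟩
      ⟨f, isContPSH_posLog_inner _ _, fun _ => rfl⟩
    simp only [ContinuousMap.coe_mk] at hJf
    have hle : ∫ x : D, f x ∂μ ≤
        ∫ x : D, (t + Real.posLog B) - ({p} : Set D).indicator (fun _ => t + Real.posLog B) x ∂μ := by
      refine integral_mono_of_nonneg (Eventually.of_forall fun _ => Real.posLog_nonneg)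
        ((integrable_const _).sub ((integrable_const _).indicator (measurableSet_singleton p)))
        (Eventually.of_forall fun x => ?_)
      by_cases hx : x = p
      · subst hx
        simp [hfp]
      · simpa [hx] using hub x x.2
    rw [integral_sub (integrable_const _) ((integrable_const _).indicator
      (measurableSet_singleton p)), integral_indicator_const _ (measurableSet_singleton p)] at hle
    simp only [integral_const, probReal_univ, smul_eq_mul, one_mul] at hle
    have h3 : 0 ≤ P * Real.posLog B := mul_nonneg hP0 Real.posLog_nonneg
    nlinarith
  have hPz : P = 0 := by
    by_contra hne
    have hpos : 0 < P := lt_of_le_of_ne hP0 (Ne.symm hne)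
    set C : ℝ := Real.posLog B - Real.log A with hC
    -- For this `t` the bound would read `|C| + 1 ≤ C`.
    have := key ((|C| + 1) / P) (by positivity)
    rw [div_mul_cancel₀ _ hne] at this
    linarith [le_abs_self C]
  exact (measureReal_eq_zero_iff).1 hPz

lemma edwardsI_negChar_eq_zero (hDb : Bornology.IsBounded D) (hL : L.Countable) {z : D}
    (hz : (z : EuclideanSpace ℂ (Fin n)) ∉ L) :
    edwardsI (contPSHCone D) (negChar D L) z = 0 := by
  refine le_antisymm (sInf_le ⟨Measure.dirac z, ⟨inferInstance, ⟨{z}, isCompact_singleton, ?_⟩,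
    fun u _ => ?_⟩, ?_⟩) (le_sInf ?_)
  · simp
  · rw [integral_dirac]
  · rw [integral_dirac]
    simp [negChar, hz]
  · rintro _ ⟨μ, hμ, rfl⟩
    have hnull : μ (Subtype.val ⁻¹' L) = 0 := by
      rw [measure_null_iff_singleton (hL.preimage Subtype.val_injective)]
      rintro p hp
      refine jensenMeasures_singleton_eq_zero hDb (fun h => hz ?_) hμ
      rw [← h]
      exact hp
    have hae : negChar D L =ᵐ[μ] 0 := by
      filter_upwards [measure_eq_zero_iff_ae_notMem.1 hnull] with x hx
      simpa [negChar] using hx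
    rw [integral_congr_ae hae]
    simp

lemma edwardsS_negChar_le (hL : IsDiscreteApprox D V L)
    (z : D) : edwardsS (contPSHCone D) (negChar D L) z ≤ boundaryExtremal V D z := by
  refine sSup_le ?_
  rintro _ ⟨f, ⟨h, hh, hf⟩, hfle, rfl⟩
  refine le_sSup ⟨fun w => (h w : EReal), ⟨hh.2, fun w hw => ?_⟩, fun ζ hζ => ?_, by rw [hf]⟩
  · have := hfle ⟨w, hw⟩
    rw [hf] at this
    refine EReal.coe_le_coe_iff.2 (this.trans ?_)
    exact neg_nonpos.2 (indicator_nonneg (fun _ _ => zero_le_one) _)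
  · have hζL : ζ ∈ closure L := by
      rw [hL.closure_eq]
      exact Or.inr (subset_closure hζ)
    have hζD : ζ ∈ closure D := closure_mono hL.subset hζL
    -- Continuity on `closure D` carries the bound from `L` to its limit points on the boundary.
    have hle : h ζ ≤ -1 := by
      have hne : (𝓝[L] ζ).NeBot := mem_closure_iff_nhdsWithin_neBot.1 hζL
      refine le_of_tendsto ((hh.1 ζ hζD).mono (hL.subset.trans subset_closure))
        (eventually_nhdsWithin_of_forall fun w hw => ?_)
      have := hfle ⟨w, hL.subset hw⟩
      rw [hf] at this
      simpa [negChar, hw] using this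
    have hne : (𝓝[D] ζ).NeBot := mem_closure_iff_nhdsWithin_neBot.1 hζD
    have htend : Tendsto (fun w => (h w : EReal)) (𝓝[D] ζ) (𝓝 (h ζ : EReal)) :=
      (continuous_coe_real_ereal.tendsto _).comp ((hh.1 ζ hζD).mono subset_closure)
    rw [upperReg, htend.limsup_eq]
    simpa using EReal.coe_le_coe_iff.2 hle

end Edwards

/-! ### The failure of Edwards' theorem on `D`. -/

theorem mainTheorem7 {n : ℕ} (D : Set (EuclideanSpace ℂ (Fin n)))
    (hD_open : IsOpen D) (hD_conn : IsConnected D) (hD_bdd : Bornology.IsBounded D)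
    (hD_reg : IsBRegular D)
    (V : Set (EuclideanSpace ℂ (Fin n)))
    (hV_open : ∃ O : Set (EuclideanSpace ℂ (Fin n)), IsOpen O ∧ V = O ∩ frontier D)
    (hV_ne : V.Nonempty) :
    -- neither `V` nor its closure is b-pluripolar
    ¬ IsBPluripolar D (closure V) ∧ ¬ IsBPluripolar D V ∧
    (∀ z ∈ D, boundaryExtremal V D z < 0) ∧
    -- sets `L` as required exist
    (∃ L, IsDiscreteApprox D V L) ∧
    -- the cone `F = PSH(D) ∩ C(closure D)` and the failure for `g = -χ_L`
    (∃ F : ConvexCone ℝ C(D, ℝ),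
      (∀ f : C(D, ℝ), f ∈ F ↔ ∃ h, IsContPSH D h ∧ ∀ x : D, f x = h x) ∧
      (∀ c : ℝ, ContinuousMap.const D c ∈ F) ∧
      ∀ L, IsDiscreteApprox D V L →
        Measurable (negChar D L) ∧ (∀ x, |negChar D L x| ≤ 1) ∧
        LowerSemicontinuous (negChar D L) ∧
        (∀ z : D, edwardsS F (negChar D L) z ≤ boundaryExtremal V D z) ∧
        (∀ z : D, (z : EuclideanSpace ℂ (Fin n)) ∉ L → edwardsI F (negChar D L) z = 0) ∧
        (∀ z : D, (z : EuclideanSpace ℂ (Fin n)) ∉ L →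
          edwardsS F (negChar D L) z < edwardsI F (negChar D L) z) ∧
        (∃ z : D, (z : EuclideanSpace ℂ (Fin n)) ∉ L)) ∧
    -- consequently Edwards' theorem is false on `D`
    ¬ EdwardsHolds D := by
  obtain ⟨O, hO, rfl⟩ := hV_open
  have hVf : O ∩ frontier D ⊆ frontier D := inter_subset_right
  have hDc := hD_conn.isPreconnected
  have : Nontrivial (EuclideanSpace ℂ (Fin n)) := by
    obtain ⟨z, hz⟩ := hD_conn.nonempty
    obtain ⟨ζ, hζ⟩ := hV_ne
    exact ⟨z, ζ, fun h =>
      disjoint_left.1 (disjoint_closure_of_subset_frontier hD_open hVf) hz (h ▸ subset_closure hζ)⟩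
  have hnot := hD_reg.not_isBPluripolar hD_open hDc hD_bdd hO hV_ne
  have hneg : ∀ z ∈ D, boundaryExtremal (O ∩ frontier D) D z < 0 := fun z hz =>
    hD_reg.boundaryExtremal_neg hD_open hDc hD_bdd hO hV_ne hz
  obtain ⟨L₀, hL₀⟩ := exists_isDiscreteApprox hD_open hD_bdd hVf hV_ne
  have hlt : ∀ L, IsDiscreteApprox D (O ∩ frontier D) L → ∀ z : D,
      (z : EuclideanSpace ℂ (Fin n)) ∉ L →
        edwardsS (contPSHCone D) (negChar D L) z < edwardsI (contPSHCone D) (negChar D L) z := by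
    intro L hL z hz
    rw [edwardsI_negChar_eq_zero hD_bdd hL.countable hz]
    exact (edwardsS_negChar_le hL z).trans_lt (hneg z z.2)
  refine ⟨fun ⟨u, hu, hne, h⟩ => hnot ⟨u, hu, hne, fun ζ hζ => h ζ (subset_closure hζ)⟩, hnot, hneg,
    ⟨L₀, hL₀⟩, ⟨contPSHCone D, fun _ => mem_contPSHCone, const_mem_contPSHCone, fun L hL =>
      ⟨measurable_negChar hL.countable, abs_negChar_le,
        hL.lowerSemicontinuous_negChar hD_open hVf, edwardsS_negChar_le hL,
        fun z hz => edwardsI_negChar_eq_zero hD_bdd hL.countable hz, hlt L hL,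
        hL.exists_notMem hD_open hD_conn.nonempty⟩⟩, fun hE => ?_⟩
  obtain ⟨z, hz⟩ := hL₀.exists_notMem hD_open hD_conn.nonempty
  exact (hlt L₀ hL₀ z hz).ne ((hE (contPSHCone D) const_mem_contPSHCone (negChar D L₀)
    (measurable_negChar hL₀.countable) ⟨1, abs_negChar_le⟩).2
    (hL₀.lowerSemicontinuous_negChar hD_open hVf) z)
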